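/- Let $\mathscr{X}$ be a finite non-empty set (the state space), let $\mathscr{X}^*=\bigcup_{n\ge 0}\mathscr{X}^n$ be the set of situations (finite strings, including the empty one), and let $\Omega=\mathscr{X}^{\mathbb{N}}$ be the set of paths; for $\omega\in\Omega$ write $\omega^n\in\mathscr{X}^n$ for its first $n$ states, and for $s\in\mathscr{X}^n$ let $\Gamma(s)=\{\omega\in\Omega:\omega^n=s\}$. A map into $\overline{\mathbb{R}}=\mathbb{R}\cup\{\pm\infty\}$ is called bounded below if it is everywhere $\ge M$ for some real $M$. For every $s\in\mathscr{X}^*$ let a local upper expectation $\overline{\mathrm{Q}}_s$ be given (an imprecise probabilities tree), that is, a map from the set of all functions $\mathscr{X}\to\overline{\mathbb{R}}$ to $\overline{\mathbb{R}}$ such that, for all bounded-below $f,g:\mathscr{X}\to\overline{\mathbb{R}}$, (E1) $\overline{\mathrm{Q}}_s(c)=c$ for every real constant $c$; (E2) $\overline{\mathrm{Q}}_s(f+g)\le\overline{\mathrm{Q}}_s(f)+\overline{\mathrm{Q}}_s(g)$; (E3) $\overline{\mathrm{Q}}_s(\lambda f)=\lambda\,\overline{\mathrm{Q}}_s(f)$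 for every real $\lambda>0$; (E4) $f\le g$ implies $\overline{\mathrm{Q}}_s(f)\le\overline{\mathrm{Q}}_s(g)$; (E5) $\lim_{n\to\infty}\overline{\mathrm{Q}}_s(f_n)=\overline{\mathrm{Q}}_s(\lim_{n\to\infty}f_n)$ for every non-decreasing sequence $(f_n)_{n\ge0}$ of non-negative functions $\mathscr{X}\to\overline{\mathbb{R}}$. A supermartingale is a map $\mathscr{M}:\mathscr{X}^*\to\overline{\mathbb{R}}$ such that $\overline{\mathrm{Q}}_s(\mathscr{M}(s\,\cdot))\le\mathscr{M}(s)$ for all $s\in\mathscr{X}^*$, where $\mathscr{M}(s\,\cdot)$ is the function $x\mapsto\mathscr{M}(sx)$ on $\mathscr{X}$. For $f:\Omega\to\overline{\mathbb{R}}$ and $s\in\mathscr{X}^*$, the global game-theoretic upper expectation is $$\overline{\mathrm{E}}_{\mathrm{V}}(f\vert s)=\inf\Big\{\mathscr{M}(s):\ \mathscr{M}\text{ is a bounded-below supermartingale and }\liminf_{n\to\infty}\mathscr{M}(\omega^n)\ge f(\omega)\text{ for all }\omega\in\Gamma(s)\Big\}.$$ Then (Fatou's Lemma), for every situation $s\in\mathscr{X}^*$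 and every sequence $(f_n)_{n\ge0}$ of functions $f_n:\Omega\to\overline{\mathbb{R}}$ that is uniformly bounded below (there is a real $M$ with $f_n\ge M$ for all $n$), $$\overline{\mathrm{E}}_{\mathrm{V}}(f\vert s)\le\liminf_{n\to\infty}\overline{\mathrm{E}}_{\mathrm{V}}(f_n\vert s),\qquad\text{where } f=\liminf_{n\to\infty}f_n\text{ pointwise}.$$ -/

import Mathlib

open Filter Topology

namespace GameTheoretic

/-- An extended real variable is bounded below if it is everywhere at least some *real* number. -/
def BoundedBelow {Y : Type*} (f : Y → EReal) : Prop :=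
  ∃ M : ℝ, ∀ y, (M : EReal) ≤ f y

/-- A sequence of extended real variables is uniformly bounded below if one real number bounds
all its members from below. -/
def UniformlyBoundedBelow {Y : Type*} (f : ℕ → Y → EReal) : Prop :=
  ∃ M : ℝ, ∀ n y, (M : EReal) ≤ f n y

/-- Upper expectations on the set of all extended real variables on `Y`. Only bounded-below
variables are constrained. On these, `f + g` never meets `∞ - ∞`, and `const` with `mono` forces
`E f ≠ -∞`, so `E f + E g` does not either: the convention chosen for `∞ - ∞` is irrelevant. -/
structure IsUpperExpectation {Y : Type*} (E : (Y → EReal) → EReal) : Prop where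
  const : ∀ c : ℝ, E (fun _ => (c : EReal)) = c
  subadd : ∀ f g : Y → EReal, BoundedBelow f → BoundedBelow g →
    E (fun y => f y + g y) ≤ E f + E g
  homog : ∀ (r : ℝ) (f : Y → EReal), 0 < r → BoundedBelow f →
    E (fun y => (r : EReal) * f y) = (r : EReal) * E f
  mono : ∀ f g : Y → EReal, BoundedBelow f → BoundedBelow g → (∀ y, f y ≤ g y) → E f ≤ E g
  continuous : ∀ (f : ℕ → Y → EReal) (g : Y → EReal),
    (∀ n y, f n y ≤ f (n + 1) y) → (∀ n y, 0 ≤ f n y) →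
    (∀ y, Tendsto (fun n => f n y) atTop (𝓝 (g y))) →
    Tendsto (fun n => E (f n)) atTop (𝓝 (E g))

/-- A situation is a finite string of states `x₁, …, xₙ`, in order of time; the empty list is the
initial situation. -/
abbrev Situation (X : Type*) := List X

/-- A path is an infinite sequence of states; `ω k` is the state at time `k + 1`. -/
abbrev Path (X : Type*) := ℕ → X

/-- The situation formed by the first `n` states of the path `ω`. -/
def Path.initial {X : Type*} (ω : Path X) (n : ℕ) : Situation X :=
  List.ofFn (fun i : Fin n => ω i)

/-- The cylinder event of all paths that go through the situation `s`. -/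
def cylinder {X : Type*} (s : Situation X) : Set (Path X) :=
  {ω | Path.initial ω s.length = s}

/-- An imprecise probabilities tree: one local upper expectation for every situation. -/
structure ImpreciseProbabilitiesTree (X : Type*) where
  localE : Situation X → (X → EReal) → EReal
  isUpperExpectation : ∀ s, IsUpperExpectation (localE s)

variable {X : Type*}

/-- Supermartingales: extended real processes `M` with `E_s (M (s ·)) ≤ M s` in all situations. -/
def IsSupermartingale (T : ImpreciseProbabilitiesTree X) (M : Situation X → EReal) : Prop :=
  ∀ s, T.localE s (fun x => M (s ++ [x])) ≤ M s

/-- The global variable `liminf M`. -/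
noncomputable def processLiminf (M : Situation X → EReal) (ω : Path X) : EReal :=
  liminf (fun n => M (Path.initial ω n)) atTop

/-- The global game-theoretic upper expectation of `f` conditional on the situation `s`. -/
noncomputable def upperE (T : ImpreciseProbabilitiesTree X) (f : Path X → EReal)
    (s : Situation X) : EReal :=
  sInf {a | ∃ M : Situation X → EReal, IsSupermartingale T M ∧ BoundedBelow M ∧
    (∀ ω ∈ cylinder s, f ω ≤ processLiminf M ω) ∧ a = M s}

end GameTheoretic

/-!
By monotone convergence, Fatou's lemma reduces to continuity from below along a sequence
`0 ≤ g₀ ≤ g₁ ≤ ⋯`. The global upper expectations `V n` of the `g n` are supermartingales, hence so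
is `⨆ n, V n` by continuity of the local models. Lévy's zero-one law says that `g n ≤ liminf V n`
outside a null event, and countably many null events are negligible together.

For Lévy's law, let `f ≥ 0` have global upper expectation `V`, let `0 < a < b`, and let `A` be the
event that `V` is infinitely often below `a` although `f` exceeds `b`. If `A` has upper probability
at most `p` in all situations, wait until `V < a`, then follow `p / b` times a supermartingale for
`f` that starts below `a`, until that supermartingale exceeds `b`. This costs `p / b * a` and ends
with at least `p`, so the upper probability of `A` is at most `p * (a / b)` everywhere; for the
least such `p` this forces `p = 0`.
-/

namespace GameTheoretic

variable {X : Type*}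

/-! ### Paths and situations -/

@[simp]
theorem Path.length_initial (ω : Path X) (n : ℕ) : (Path.initial ω n).length = n :=
  List.length_ofFn

theorem Path.initial_succ (ω : Path X) (n : ℕ) :
    Path.initial ω (n + 1) = Path.initial ω n ++ [ω n] :=
  List.ofFn_succ_last

theorem Path.initial_prefix_initial (ω : Path X) {m n : ℕ} (h : m ≤ n) :
    Path.initial ω m <+: Path.initial ω n := by
  induction n, h using Nat.le_induction with
  | base => exact List.prefix_rfl
  | succ n _ ih =>
    rw [Path.initial_succ]
    exact ih.trans (List.prefix_append _ _)

theorem prefix_initial_of_mem_cylinder {ω : Path X} {s : Situation X} (h : ω ∈ cylinder s) {n : ℕ}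
    (hn : s.length ≤ n) : s <+: Path.initial ω n := by
  have := Path.initial_prefix_initial ω hn
  rwa [show Path.initial ω s.length = s from h] at this

theorem mem_cylinder_of_prefix_initial {ω : Path X} {s : Situation X} {n : ℕ}
    (h : s <+: Path.initial ω n) : ω ∈ cylinder s := by
  have hn : s.length ≤ n := by simpa using h.length_le
  exact (List.prefix_of_prefix_length_le (Path.initial_prefix_initial ω hn) h
    (by simp)).eq_of_length (by simp)

theorem cylinder_subset_of_prefix {s t : Situation X} (h : s <+: t) : cylinder t ⊆ cylinder s :=
  fun _ hω => mem_cylinder_of_prefix_initial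
    (h.trans (prefix_initial_of_mem_cylinder hω le_rfl))

theorem exists_path_initial_eq_append (s : Situation X) (ω : Path X) :
    ∃ ω' : Path X, ∀ n, Path.initial ω' (s.length + n) = s ++ Path.initial ω n := by
  refine ⟨fun k => if h : k < s.length then s[k] else ω (k - s.length), fun n => ?_⟩
  induction n with
  | zero => exact List.ext_getElem (by simp [Path.initial]) (by simp +contextual [Path.initial])
  | succ n ih => rw [← add_assoc, Path.initial_succ, Path.initial_succ, ih]; simp

theorem exists_path_forall_of_step {P : Situation X → Prop} {s : Situation X} (hs : P s)
    (step : ∀ t, P t → ∃ x, P (t ++ [x])) :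
    ∃ ω ∈ cylinder s, ∀ n, s.length ≤ n → P (Path.initial ω n) := by
  choose next hnext using step
  let run : ℕ → {t // P t} := fun n =>
    n.rec ⟨s, hs⟩ fun _ t => ⟨t ++ [next t t.2], hnext t t.2⟩
  let x : ℕ → X := fun n => next (run n).1 (run n).2
  obtain ⟨ω, hω⟩ := exists_path_initial_eq_append s x
  have hrun : ∀ n, Path.initial ω (s.length + n) = (run n).1 := by
    intro n
    rw [hω]
    induction n with
    | zero => simp [Path.initial, run]
    | succ n ih => rw [Path.initial_succ, ← List.append_assoc, ih]
  refine ⟨ω, hrun 0, fun n hn => ?_⟩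
  obtain ⟨k, rfl⟩ := Nat.exists_eq_add_of_le hn
  exact hrun k ▸ (run k).2

/-! ### Extended real variables -/

theorem ereal_le_of_forall_pos_le_add {x y : EReal} (h : ∀ ε : ℝ, 0 < ε → x ≤ y + ε) :
    x ≤ y := by
  refine EReal.le_of_forall_lt_iff_le.1 fun z hyz => ?_
  obtain ⟨w, hyw, hwz⟩ := EReal.lt_iff_exists_real_btwn.1 hyz
  calc x ≤ y + (z - w : ℝ) := h _ (sub_pos.2 (EReal.coe_lt_coe_iff.1 hwz))
    _ ≤ w + (z - w : ℝ) := add_le_add_left hyw.le _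
    _ = z := by rw [← EReal.coe_add, add_sub_cancel]

theorem ereal_coe_sum {ι : Type*} (u : ι → ℝ) (A : Finset ι) :
    ((∑ i ∈ A, u i : ℝ) : EReal) = ∑ i ∈ A, (u i : EReal) :=
  map_sum (⟨⟨(↑), EReal.coe_zero⟩, EReal.coe_add⟩ : ℝ →+ EReal) u A

theorem ereal_iSup_natCast : ⨆ n : ℕ, (n : EReal) = ⊤ := by
  refine (EReal.eq_top_iff_forall_lt _).2 fun r => ?_
  obtain ⟨n, hn⟩ := exists_nat_gt r
  exact lt_iSup_iff.2 ⟨n, by exact_mod_cast hn⟩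

theorem liminf_add_coe (u : ℕ → EReal) (r : ℝ) :
    liminf (fun n => u n + (r : EReal)) atTop = liminf u atTop + r := by
  have hmono : Monotone fun x : EReal => x + (r : EReal) := fun _ _ h => add_le_add_left h _
  refine (hmono.map_liminf_of_continuousAt u ?_).symm
  exact ContinuousAt.comp (f := fun x : EReal => (x, (r : EReal)))
    (EReal.continuousAt_add (by simp) (by simp)) (by fun_prop)

theorem BoundedBelow.comp {Y Z : Type*} {f : Y → EReal} (h : BoundedBelow f) (e : Z → Y) :
    BoundedBelow fun z => f (e z) :=
  h.imp fun _ hM z => hM (e z)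

theorem BoundedBelow.add {Y : Type*} {f g : Y → EReal} (hf : BoundedBelow f)
    (hg : BoundedBelow g) : BoundedBelow fun y => f y + g y := by
  obtain ⟨M, hM⟩ := hf
  obtain ⟨N, hN⟩ := hg
  exact ⟨M + N, fun y => EReal.coe_add M N ▸ add_le_add (hM y) (hN y)⟩

theorem boundedBelow_coe {Y : Type*} (r : ℝ) : BoundedBelow fun _ : Y => (r : EReal) :=
  ⟨r, fun _ => le_rfl⟩

theorem boundedBelow_of_nonneg {Y : Type*} {f : Y → EReal} (h : 0 ≤ f) : BoundedBelow f :=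
  ⟨0, h⟩

/-! ### Supermartingales -/

theorem processLiminf_mono {M N : Situation X → EReal} (h : M ≤ N) (ω : Path X) :
    processLiminf M ω ≤ processLiminf N ω :=
  liminf_le_liminf (Eventually.of_forall fun _ => h _)

theorem processLiminf_nonneg {M : Situation X → EReal} (h : 0 ≤ M) (ω : Path X) :
    0 ≤ processLiminf M ω :=
  le_liminf_of_le (by isBoundedDefault) (Eventually.of_forall fun _ => h _)

theorem sum_processLiminf_le {ι : Type*} (M : ι → Situation X → EReal) (A : Finset ι)
    (ω : Path X) :
    ∑ i ∈ A, processLiminf (M i) ω ≤ processLiminf (fun t => ∑ i ∈ A, M i t) ω := by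
  induction A using Finset.cons_induction with
  | empty => simp [processLiminf]
  | cons i A hi ih =>
    simp only [Finset.sum_cons]
    exact (add_le_add_right ih _).trans EReal.le_liminf_add

variable {T : ImpreciseProbabilitiesTree X}

theorem isSupermartingale_coe (r : ℝ) : IsSupermartingale T fun _ => (r : EReal) :=
  fun s => ((T.isUpperExpectation s).const r).le

theorem isSupermartingale_top : IsSupermartingale T fun _ => ⊤ :=
  fun _ => le_top

theorem IsSupermartingale.add {M N : Situation X → EReal} (hM : IsSupermartingale T M)
    (hN : IsSupermartingale T N) (bM : BoundedBelow M) (bN : BoundedBelow N) :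
    IsSupermartingale T fun t => M t + N t :=
  fun s => ((T.isUpperExpectation s).subadd _ _ (bM.comp _) (bN.comp _)).trans
    (add_le_add (hM s) (hN s))

theorem IsSupermartingale.coe_mul {M : Situation X → EReal} (hM : IsSupermartingale T M)
    (bM : BoundedBelow M) {r : ℝ} (hr : 0 < r) :
    IsSupermartingale T fun t => (r : EReal) * M t := fun s => by
  rw [(T.isUpperExpectation s).homog r _ hr (bM.comp fun x => s ++ [x])]
  exact mul_le_mul_of_nonneg_left (hM s) (EReal.coe_nonneg.2 hr.le)

theorem IsSupermartingale.sum {ι : Type*} {M : ι → Situation X → EReal}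
    (hM : ∀ i, IsSupermartingale T (M i)) (hM0 : ∀ i, 0 ≤ M i) (A : Finset ι) :
    IsSupermartingale T fun t => ∑ i ∈ A, M i t := by
  induction A using Finset.cons_induction with
  | empty => simpa using isSupermartingale_coe (T := T) 0
  | cons i A hi ih =>
    simp only [Finset.sum_cons]
    exact (hM i).add ih (boundedBelow_of_nonneg (hM0 i))
      (boundedBelow_of_nonneg fun t => Finset.sum_nonneg fun k _ => hM0 k t)

theorem IsSupermartingale.iSup {M : ℕ → Situation X → EReal}
    (hM : ∀ n, IsSupermartingale T (M n)) (hM0 : ∀ n, 0 ≤ M n) (hmono : Monotone M) :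
    IsSupermartingale T fun t => ⨆ n, M n t := fun s =>
  le_of_tendsto' ((T.isUpperExpectation s).continuous (fun n x => M n (s ++ [x])) _
      (fun n _ => hmono n.le_succ _) (fun n _ => hM0 n _)
      (fun _ => tendsto_atTop_iSup fun _ _ h => hmono h _))
    fun n => (hM n s).trans (le_iSup (fun n => M n s) n)

theorem IsSupermartingale.exists_lt {M : Situation X → EReal} (hM : IsSupermartingale T M)
    (bM : BoundedBelow M) {s : Situation X} {c : ℝ} (h : M s < c) : ∃ x, M (s ++ [x]) < c := by
  by_contra! hle
  refine h.not_ge ?_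
  calc (c : EReal) = T.localE s fun _ => (c : EReal) := ((T.isUpperExpectation s).const c).symm
    _ ≤ T.localE s fun x => M (s ++ [x]) :=
      (T.isUpperExpectation s).mono _ _ (boundedBelow_coe c) (bM.comp _) hle
    _ ≤ M s := hM s

/-- A supermartingale starting below `c` can be kept below `c` along some path. -/
theorem IsSupermartingale.le_of_forall_le_processLiminf {M : Situation X → EReal}
    (hM : IsSupermartingale T M) (bM : BoundedBelow M) {s : Situation X} {a : EReal}
    (h : ∀ ω ∈ cylinder s, a ≤ processLiminf M ω) : a ≤ M s := by
  refine EReal.le_of_forall_lt_iff_le.1 fun c hc => ?_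
  obtain ⟨ω, hω, hlt⟩ := exists_path_forall_of_step (P := fun t => M t < c) hc
    fun _ => hM.exists_lt bM
  exact (h ω hω).trans (liminf_le_of_frequently_le'
    ((eventually_ge_atTop s.length).mono fun n hn => (hlt n hn).le).frequently)

/-! ### The global upper expectation -/

theorem upperE_le {f : Path X → EReal} {s : Situation X} {M : Situation X → EReal}
    (hM : IsSupermartingale T M) (bM : BoundedBelow M)
    (h : ∀ ω ∈ cylinder s, f ω ≤ processLiminf M ω) : upperE T f s ≤ M s :=
  sInf_le ⟨M, hM, bM, h, rfl⟩

theorem le_upperE {f : Path X → EReal} {s : Situation X} {a : EReal}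
    (h : ∀ M, IsSupermartingale T M → BoundedBelow M →
      (∀ ω ∈ cylinder s, f ω ≤ processLiminf M ω) → a ≤ M s) : a ≤ upperE T f s :=
  le_sInf (by rintro _ ⟨M, hM, bM, hfM, rfl⟩; exact h M hM bM hfM)

theorem upperE_mono {f g : Path X → EReal} (h : f ≤ g) (s : Situation X) :
    upperE T f s ≤ upperE T g s :=
  le_upperE fun _ hM bM hgM => upperE_le hM bM fun ω hω => (h ω).trans (hgM ω hω)

theorem upperE_le_coe {f : Path X → EReal} {r : ℝ} (h : ∀ ω, f ω ≤ r) (s : Situation X) :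
    upperE T f s ≤ r :=
  upperE_le (isSupermartingale_coe r) (boundedBelow_coe r)
    fun ω _ => (h ω).trans_eq (liminf_const _).symm

theorem le_upperE_of_forall_le {f : Path X → EReal} {a : EReal} (h : ∀ ω, a ≤ f ω)
    (s : Situation X) : a ≤ upperE T f s :=
  le_upperE fun _ hM bM hfM =>
    hM.le_of_forall_le_processLiminf bM fun ω hω => (h ω).trans (hfM ω hω)

theorem upperE_nonneg {f : Path X → EReal} (hf : 0 ≤ f) : 0 ≤ upperE T f :=
  le_upperE_of_forall_le hf

theorem BoundedBelow.upperE {f : Path X → EReal} (hf : BoundedBelow f) :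
    BoundedBelow (upperE T f) :=
  hf.imp fun _ hM => le_upperE_of_forall_le hM

theorem isSupermartingale_upperE {f : Path X → EReal} (hf : BoundedBelow f) :
    IsSupermartingale T (upperE T f) := fun s =>
  le_upperE fun M hM bM hfM => by
    refine ((T.isUpperExpectation s).mono _ _ (hf.upperE.comp _) (bM.comp _) fun x => ?_).trans
      (hM s)
    exact upperE_le hM bM fun ω hω =>
      hfM ω (cylinder_subset_of_prefix (List.prefix_append _ _) hω)

theorem upperE_add_coe_le (f : Path X → EReal) (r : ℝ) (s : Situation X) :
    upperE T (fun ω => f ω + (r : EReal)) s ≤ upperE T f s + r := by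
  rw [← EReal.sub_le_iff_le_add (by simp) (by simp)]
  refine le_upperE fun M hM bM hfM => EReal.sub_le_of_le_add ?_
  refine upperE_le (hM.add (isSupermartingale_coe r) bM (boundedBelow_coe r))
    (bM.add (boundedBelow_coe r)) fun ω hω => ?_
  rw [processLiminf, liminf_add_coe]
  exact add_le_add_left (hfM ω hω) _

theorem upperE_add_coe (f : Path X → EReal) (r : ℝ) (s : Situation X) :
    upperE T (fun ω => f ω + (r : EReal)) s = upperE T f s + r := by
  refine (upperE_add_coe_le f r s).antisymm ?_
  have h := upperE_add_coe_le (T := T) (fun ω => f ω + (r : EReal)) (-r) s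
  simp only [EReal.coe_neg, ← sub_eq_add_neg, EReal.add_sub_cancel_right] at h
  exact EReal.add_le_of_le_sub h

theorem exists_nonneg_supermartingale_of_upperE_lt {f : Path X → EReal} (hf : 0 ≤ f)
    {s : Situation X} {a : EReal} (ha : upperE T f s < a) :
    ∃ M, IsSupermartingale T M ∧ 0 ≤ M ∧ M s < a ∧
      ∀ ω ∈ cylinder s, f ω ≤ processLiminf M ω := by
  classical
  obtain ⟨_, ⟨M, hM, bM, hfM, rfl⟩, hlt⟩ := sInf_lt_iff.1 ha
  have hM0 : ∀ t, s <+: t → 0 ≤ M t := fun t ht =>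
    hM.le_of_forall_le_processLiminf bM fun ω hω =>
      (hf ω).trans (hfM ω (cylinder_subset_of_prefix ht hω))
  -- `M` may be negative off the situations that follow `s`, so it is replaced by `⊤` there.
  refine ⟨fun t => if s <+: t then M t else ⊤, fun t => ?_, fun t => ?_, by simpa using hlt,
    fun ω hω => (hfM ω hω).trans_eq (liminf_congr ?_)⟩
  · by_cases ht : s <+: t
    · simpa [ht, ht.trans (List.prefix_append t _)] using hM t
    · simp [ht]
  · dsimp only
    split_ifs with ht
    exacts [hM0 t ht, le_top]
  · filter_upwards [eventually_ge_atTop s.length] with n hn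
    simp [prefix_initial_of_mem_cylinder hω hn]

theorem exists_nonneg_supermartingale_le_upperE_add {f : Path X → EReal} (hf : 0 ≤ f)
    (s : Situation X) {ε : ℝ} (hε : 0 < ε) :
    ∃ M, IsSupermartingale T M ∧ 0 ≤ M ∧ M s ≤ upperE T f s + ε ∧
      ∀ ω ∈ cylinder s, f ω ≤ processLiminf M ω := by
  rcases eq_or_ne (upperE T f s) ⊤ with htop | htop
  · exact ⟨fun _ => ⊤, isSupermartingale_top, fun _ => le_top, by simp [htop],
      fun ω _ => le_top.trans_eq (liminf_const _).symm⟩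
  · have hlt : upperE T f s < upperE T f s + ε := by
      lift upperE T f s to ℝ using
        ⟨htop, (EReal.bot_lt_zero.trans_le (upperE_nonneg hf s)).ne'⟩ with r
      exact_mod_cast lt_add_of_pos_right r hε
    obtain ⟨M, hM, hM0, hMs, hfM⟩ := exists_nonneg_supermartingale_of_upperE_lt hf hlt
    exact ⟨M, hM, hM0, hMs.le, hfM⟩

theorem upperE_iSup_sum_le {f : ℕ → Path X → EReal} (hf : ∀ k, 0 ≤ f k) (s : Situation X) :
    upperE T (fun ω => ⨆ n, ∑ k ∈ Finset.range n, f k ω) s ≤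
      ⨆ n, ∑ k ∈ Finset.range n, upperE T (f k) s := by
  refine ereal_le_of_forall_pos_le_add fun ε hε => ?_
  obtain ⟨δ, hδ, c, hδc, hcε⟩ := posSumOfEncodable hε ℕ
  choose M hM hM0 hMs hfM using fun k =>
    exists_nonneg_supermartingale_le_upperE_add (T := T) (hf k) s (hδ k)
  have hsum0 : ∀ n, (0 : Situation X → EReal) ≤ fun t => ∑ k ∈ Finset.range n, M k t :=
    fun n t => Finset.sum_nonneg fun k _ => hM0 k t
  have hmono : Monotone fun n t => ∑ k ∈ Finset.range n, M k t := fun m n hmn t =>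
    Finset.sum_le_sum_of_subset_of_nonneg (Finset.range_mono hmn) fun k _ _ => hM0 k t
  have hW : IsSupermartingale T fun t => ⨆ n, ∑ k ∈ Finset.range n, M k t :=
    IsSupermartingale.iSup (fun n => IsSupermartingale.sum hM hM0 (Finset.range n)) hsum0 hmono
  refine (upperE_le hW (boundedBelow_of_nonneg fun t => le_iSup_of_le 0 (hsum0 0 t))
    fun ω hω => iSup_le fun n => ?_).trans (iSup_le fun n => ?_)
  · calc ∑ k ∈ Finset.range n, f k ω ≤ ∑ k ∈ Finset.range n, processLiminf (M k) ω :=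
        Finset.sum_le_sum fun k _ => hfM k ω hω
      _ ≤ processLiminf (fun t => ∑ k ∈ Finset.range n, M k t) ω := sum_processLiminf_le M _ ω
      _ ≤ _ := processLiminf_mono (fun t => le_iSup (fun n => ∑ k ∈ Finset.range n, M k t) n) ω
  · calc ∑ k ∈ Finset.range n, M k s
        ≤ ∑ k ∈ Finset.range n, (upperE T (f k) s + δ k) := Finset.sum_le_sum fun k _ => hMs k
      _ = ∑ k ∈ Finset.range n, upperE T (f k) s + (∑ k ∈ Finset.range n, δ k : ℝ) := by
        rw [Finset.sum_add_distrib, ereal_coe_sum]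
      _ ≤ _ := add_le_add (le_iSup (fun n => ∑ k ∈ Finset.range n, upperE T (f k) s) n)
        (EReal.coe_le_coe_iff.2 ((sum_le_hasSum _ (fun k _ => (hδ k).le) hδc).trans hcε))

/-! ### Upper probability and null events -/

/-- The upper probability of the event `A` conditional on the situation `s`: the global upper
expectation of the indicator of `A`. -/
noncomputable def upperProb (T : ImpreciseProbabilitiesTree X) (A : Set (Path X))
    (s : Situation X) : EReal :=
  upperE T (A.indicator 1) s

theorem indicator_one_nonneg (A : Set (Path X)) : 0 ≤ A.indicator (1 : Path X → EReal) :=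
  Set.indicator_nonneg fun _ _ => zero_le_one

theorem upperProb_nonneg (A : Set (Path X)) (s : Situation X) : 0 ≤ upperProb T A s :=
  upperE_nonneg (indicator_one_nonneg A) s

theorem upperProb_le_one (A : Set (Path X)) (s : Situation X) : upperProb T A s ≤ 1 :=
  upperE_le_coe (r := 1) (Set.indicator_le_self' fun _ _ => zero_le_one) s

theorem upperProb_mono {A B : Set (Path X)} (h : A ⊆ B) (s : Situation X) :
    upperProb T A s ≤ upperProb T B s :=
  upperE_mono (Set.indicator_le_indicator_of_subset h fun _ => zero_le_one) s

theorem upperProb_empty (s : Situation X) : upperProb T ∅ s = 0 :=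
  (upperE_le_coe (r := 0) (by simp) s).antisymm (upperProb_nonneg ∅ s)

theorem upperProb_iUnion_eq_zero {ι : Type*} [Countable ι] {A : ι → Set (Path X)}
    {s : Situation X} (hA : ∀ i, upperProb T (A i) s = 0) : upperProb T (⋃ i, A i) s = 0 := by
  cases isEmpty_or_nonempty ι
  · rw [Set.iUnion_of_empty, upperProb_empty]
  obtain ⟨e, he⟩ := exists_surjective_nat ι
  refine le_antisymm ?_ (upperProb_nonneg _ s)
  calc upperProb T (⋃ i, A i) s
      ≤ upperE T (fun ω => ⨆ n, ∑ k ∈ Finset.range n, (A (e k)).indicator 1 ω) s := by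
        refine upperE_mono (Set.indicator_le' (fun ω hω => ?_) fun ω _ => ?_) s
        · obtain ⟨i, hi⟩ := Set.mem_iUnion.1 hω
          obtain ⟨k, rfl⟩ := he i
          calc (1 : EReal) = (A (e k)).indicator 1 ω := (Set.indicator_of_mem hi 1).symm
            _ ≤ ∑ j ∈ Finset.range (k + 1), (A (e j)).indicator 1 ω :=
              Finset.single_le_sum (f := fun j => (A (e j)).indicator (1 : Path X → EReal) ω)
                (fun j _ => indicator_one_nonneg _ ω) (Finset.self_mem_range_succ k)
            _ ≤ _ := le_iSup (fun n => ∑ j ∈ Finset.range n, (A (e j)).indicator 1 ω) (k + 1)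
        · exact le_iSup_of_le 0 (by simp)
    _ ≤ ⨆ n, ∑ k ∈ Finset.range n, upperProb T (A (e k)) s :=
        upperE_iSup_sum_le (fun k => indicator_one_nonneg _) s
    _ = 0 := by simp [hA]

theorem upperE_indicator_top_of_upperProb_eq_zero {A : Set (Path X)} {s : Situation X}
    (hA : upperProb T A s = 0) : upperE T (A.indicator ⊤) s = 0 := by
  refine le_antisymm ?_ (upperE_nonneg (Set.indicator_nonneg fun _ _ => le_top) s)
  calc upperE T (A.indicator ⊤) s
      ≤ upperE T (fun ω => ⨆ n, ∑ _k ∈ Finset.range n, A.indicator 1 ω) s := by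
        refine upperE_mono (Set.indicator_le' (fun ω hω => ?_) fun ω _ => ?_) s
        · simp [hω, ereal_iSup_natCast]
        · exact le_iSup_of_le 0 (by simp)
    _ ≤ ⨆ n, ∑ _k ∈ Finset.range n, upperProb T A s :=
        upperE_iSup_sum_le (fun _ => indicator_one_nonneg A) s
    _ = 0 := by simp [hA]

theorem upperE_le_of_forall_notMem_null {f : Path X → EReal} {M : Situation X → EReal}
    (hM : IsSupermartingale T M) (hM0 : 0 ≤ M) {A : Set (Path X)} {s : Situation X}
    (hA : upperProb T A s = 0)
    (h : ∀ ω ∈ cylinder s, ω ∉ A → f ω ≤ processLiminf M ω) : upperE T f s ≤ M s := by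
  refine ereal_le_of_forall_pos_le_add fun ε hε => ?_
  obtain ⟨W, hW, hW0, hWs, hWA⟩ := exists_nonneg_supermartingale_le_upperE_add (T := T)
    (f := A.indicator ⊤) (Set.indicator_nonneg fun _ _ => le_top) s hε
  rw [upperE_indicator_top_of_upperProb_eq_zero hA, zero_add] at hWs
  refine (upperE_le (hM.add hW (boundedBelow_of_nonneg hM0) (boundedBelow_of_nonneg hW0))
    (boundedBelow_of_nonneg fun t => add_nonneg (hM0 t) (hW0 t)) fun ω hω => ?_).trans
    (add_le_add_right hWs _)
  by_cases hωA : ω ∈ A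
  · calc f ω ≤ A.indicator ⊤ ω := by simp [hωA]
      _ ≤ processLiminf W ω := hWA ω hω
      _ ≤ _ := processLiminf_mono (fun t => le_add_of_nonneg_left (hM0 t)) ω
  · exact (h ω hω hωA).trans (processLiminf_mono (fun t => le_add_of_nonneg_right (hW0 t)) ω)

/-! ### Switching at the first visit to a set of situations -/

open Classical in
/-- The shortest prefix of the situation `t` that belongs to `U`, if there is one: the place where
a path through `t` first visits `U`. -/
noncomputable def firstHit (U : Set (Situation X)) (t : Situation X) : Option (Situation X) :=
  t.inits.find? (· ∈ U)

theorem mem_of_firstHit_eq_some {U : Set (Situation X)} {t v : Situation X}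
    (h : firstHit U t = some v) : v ∈ U := by
  simpa using List.find?_some h

theorem prefix_of_firstHit_eq_some {U : Set (Situation X)} {t v : Situation X}
    (h : firstHit U t = some v) : v <+: t :=
  (List.mem_inits v t).1 (List.mem_of_find?_eq_some h)

theorem notMem_of_firstHit_eq_none {U : Set (Situation X)} {t : Situation X}
    (h : firstHit U t = none) : t ∉ U := by
  simpa using List.find?_eq_none.1 h t ((List.mem_inits t t).2 List.prefix_rfl)

theorem firstHit_of_prefix {U : Set (Situation X)} {t u v : Situation X} (h : t <+: u)
    (ht : firstHit U t = some v) : firstHit U u = some v := by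
  obtain ⟨r, rfl⟩ := h
  rw [firstHit, List.inits_append]
  exact (List.prefix_append _ _).find?_eq_some ht

open Classical in
theorem firstHit_concat_of_firstHit_eq_none {U : Set (Situation X)} {t : Situation X}
    (h : firstHit U t = none) (x : X) :
    firstHit U (t ++ [x]) = if t ++ [x] ∈ U then some (t ++ [x]) else none := by
  rw [firstHit] at h ⊢
  simp [List.inits_append, h]

/-- The process that follows `M` until a situation `v` in `U` is reached, and `N v` from then on; it
changes the betting strategy at the time of that first visit. -/
noncomputable def switch (U : Set (Situation X)) (M : Situation X → EReal)
    (N : Situation X → Situation X → EReal) (t : Situation X) : EReal :=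
  (firstHit U t).elim (M t) fun v => N v t

section Switch

variable {U : Set (Situation X)} {M : Situation X → EReal} {N : Situation X → Situation X → EReal}

theorem switch_of_firstHit_eq_some {t v : Situation X} (h : firstHit U t = some v) :
    switch U M N t = N v t := by
  rw [switch, h, Option.elim_some]

theorem switch_of_firstHit_eq_none {t : Situation X} (h : firstHit U t = none) :
    switch U M N t = M t := by
  rw [switch, h, Option.elim_none]

theorem switch_nonneg (hM : 0 ≤ M) (hN : ∀ v, 0 ≤ N v) : 0 ≤ switch U M N := fun t => by
  cases h : firstHit U t with
  | some v => exact (hN v t).trans_eq (switch_of_firstHit_eq_some h).symm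
  | none => exact (hM t).trans_eq (switch_of_firstHit_eq_none h).symm

theorem switch_le_of_forall_prefix (hNM : ∀ v ∈ U, N v v ≤ M v) {t : Situation X}
    (ht : ∀ v ∈ U, t <+: v) : switch U M N t ≤ M t := by
  cases h : firstHit U t with
  | some v =>
    have hv := mem_of_firstHit_eq_some h
    obtain rfl : t = v := (ht v hv).eq_of_length_le (prefix_of_firstHit_eq_some h).length_le
    exact (switch_of_firstHit_eq_some h).trans_le (hNM t hv)
  | none => exact (switch_of_firstHit_eq_none h).le

theorem processLiminf_switch_of_firstHit_eq_some {ω : Path X} {k : ℕ} {v : Situation X}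
    (h : firstHit U (Path.initial ω k) = some v) :
    processLiminf (switch U M N) ω = processLiminf (N v) ω := by
  refine liminf_congr ?_
  filter_upwards [eventually_ge_atTop k] with n hn
  exact switch_of_firstHit_eq_some
    (firstHit_of_prefix (Path.initial_prefix_initial ω hn) h)

theorem processLiminf_switch_of_forall_firstHit_eq_none {ω : Path X}
    (h : ∀ k, firstHit U (Path.initial ω k) = none) :
    processLiminf (switch U M N) ω = processLiminf M ω :=
  liminf_congr (Eventually.of_forall fun k => switch_of_firstHit_eq_none (h k))

theorem isSupermartingale_switch (hM : IsSupermartingale T M) (hN : ∀ v, IsSupermartingale T (N v))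
    (hM0 : 0 ≤ M) (hN0 : ∀ v, 0 ≤ N v) (hNM : ∀ v ∈ U, N v v ≤ M v) :
    IsSupermartingale T (switch U M N) := by
  intro t
  cases ht : firstHit U t with
  | some v =>
    have hx : ∀ x, switch U M N (t ++ [x]) = N v (t ++ [x]) := fun x =>
      switch_of_firstHit_eq_some (firstHit_of_prefix (List.prefix_append t [x]) ht)
    simpa only [hx, switch_of_firstHit_eq_some ht] using hN v t
  | none =>
    have hx : ∀ x, switch U M N (t ++ [x]) ≤ M (t ++ [x]) := by
      intro x
      rw [switch, firstHit_concat_of_firstHit_eq_none ht]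
      split_ifs with hU
      exacts [hNM _ hU, le_rfl]
    rw [switch_of_firstHit_eq_none ht]
    exact ((T.isUpperExpectation t).mono _ _
      (boundedBelow_of_nonneg fun x => switch_nonneg hM0 hN0 _)
      ((boundedBelow_of_nonneg hM0).comp _) hx).trans (hM t)

end Switch

/-- As soon as `M` pays for the upper expectation of `f`, one can switch from `M` to an (almost)
optimal supermartingale for `f`. -/
theorem upperE_le_of_le_processLiminf_or_upperE_le {f : Path X → EReal} (hf : 0 ≤ f)
    {M : Situation X → EReal} (hM : IsSupermartingale T M) (hM0 : 0 ≤ M) {t : Situation X}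
    (h : ∀ ω ∈ cylinder t, f ω ≤ processLiminf M ω ∨
      ∃ k, t.length ≤ k ∧ upperE T f (Path.initial ω k) ≤ M (Path.initial ω k)) :
    upperE T f t ≤ M t := by
  refine ereal_le_of_forall_pos_le_add fun ε hε => ?_
  have hε0 : (0 : EReal) ≤ ε := EReal.coe_nonneg.2 hε.le
  let U : Set (Situation X) := {v | t <+: v ∧ upperE T f v ≤ M v}
  let Mε : Situation X → EReal := fun u => M u + ε
  choose N hN hN0 hNv hfN using fun v =>
    exists_nonneg_supermartingale_le_upperE_add (T := T) hf v hε
  have hMε : IsSupermartingale T Mε :=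
    hM.add (isSupermartingale_coe ε) (boundedBelow_of_nonneg hM0) (boundedBelow_coe ε)
  have hMε0 : 0 ≤ Mε := fun u => add_nonneg (hM0 u) hε0
  have hNM : ∀ v ∈ U, N v v ≤ Mε v := fun v hv => (hNv v).trans (add_le_add_left hv.2 _)
  refine (upperE_le (isSupermartingale_switch hMε hN hMε0 hN0 hNM)
    (boundedBelow_of_nonneg (switch_nonneg hMε0 hN0)) fun ω hω => ?_).trans
    (switch_le_of_forall_prefix hNM fun v hv => hv.1)
  by_cases hhit : ∃ k v, firstHit U (Path.initial ω k) = some v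
  · obtain ⟨k, v, hk⟩ := hhit
    rw [processLiminf_switch_of_firstHit_eq_some hk]
    exact hfN v ω (mem_cylinder_of_prefix_initial (prefix_of_firstHit_eq_some hk))
  · have hnone : ∀ k, firstHit U (Path.initial ω k) = none := fun k =>
      Option.eq_none_iff_forall_ne_some.2 fun v hv => hhit ⟨k, v, hv⟩
    rw [processLiminf_switch_of_forall_firstHit_eq_none hnone]
    rcases h ω hω with hle | ⟨k, hk, hle⟩
    · exact hle.trans (processLiminf_mono (fun u => le_add_of_nonneg_right hε0) ω)
    · exact absurd ⟨prefix_initial_of_mem_cylinder hω hk, hle⟩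
        (notMem_of_firstHit_eq_none (hnone k))

theorem upperProb_le_of_forall_exists_upperProb_le {A : Set (Path X)} {M : Situation X → EReal}
    (hM : IsSupermartingale T M) (hM0 : 0 ≤ M) {t : Situation X}
    (h : ∀ ω ∈ cylinder t, ω ∈ A →
      ∃ k, t.length ≤ k ∧ upperProb T A (Path.initial ω k) ≤ M (Path.initial ω k)) :
    upperProb T A t ≤ M t := by
  refine upperE_le_of_le_processLiminf_or_upperE_le (indicator_one_nonneg A) hM hM0
    fun ω hω => ?_
  by_cases hωA : ω ∈ A
  · exact Or.inr (h ω hω hωA)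
  · exact Or.inl ((Set.indicator_of_notMem hωA 1).trans_le (processLiminf_nonneg hM0 ω))

/-! ### Lévy's zero-one law -/

theorem upperProb_le_div_mul_of_upperE_lt {f : Path X → EReal} (hf : 0 ≤ f) {A : Set (Path X)}
    {a b p : ℝ} (hb : 0 < b) (hp : 0 < p) (hA : ∀ ω ∈ A, b < f ω)
    (hAp : ∀ v, upperProb T A v ≤ p) {u : Situation X} (hu : upperE T f u < a) :
    upperProb T A u ≤ (p / b * a : ℝ) := by
  obtain ⟨N, hN, hN0, hNu, hfN⟩ := exists_nonneg_supermartingale_of_upperE_lt hf hu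
  have hr : 0 < p / b := div_pos hp hb
  have hr0 : (0 : EReal) ≤ (p / b : ℝ) := EReal.coe_nonneg.2 hr.le
  calc upperProb T A u ≤ (p / b : ℝ) * N u := by
        refine upperProb_le_of_forall_exists_upperProb_le
          (hN.coe_mul (boundedBelow_of_nonneg hN0) hr) (fun t => mul_nonneg hr0 (hN0 t))
          fun ω hω hωA => ?_
        have hbN : b < processLiminf N ω := (hA ω hωA).trans_le (hfN ω hω)
        obtain ⟨k, hk, hbk⟩ := ((eventually_ge_atTop u.length).and
          (eventually_lt_of_lt_liminf hbN)).exists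
        refine ⟨k, hk, ?_⟩
        calc upperProb T A (Path.initial ω k) ≤ p := hAp _
          _ = (p / b : ℝ) * b := by rw [← EReal.coe_mul, div_mul_cancel₀ p hb.ne']
          _ ≤ (p / b : ℝ) * N (Path.initial ω k) := mul_le_mul_of_nonneg_left hbk.le hr0
    _ ≤ (p / b : ℝ) * a := mul_le_mul_of_nonneg_left hNu.le hr0
    _ = (p / b * a : ℝ) := (EReal.coe_mul _ _).symm

theorem upperProb_frequently_upperE_lt_and_lt_eq_zero {f : Path X → EReal} (hf : 0 ≤ f) {a b : ℝ}
    (ha : 0 < a) (hab : a < b) (s : Situation X) :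
    upperProb T {ω | (∃ᶠ k in atTop, upperE T f (Path.initial ω k) < a) ∧ b < f ω} s = 0 := by
  set A : Set (Path X) := {ω | (∃ᶠ k in atTop, upperE T f (Path.initial ω k) < a) ∧ b < f ω}
  have hle : ∀ t, upperProb T A t ≤ ⨆ t, upperProb T A t := le_iSup (upperProb T A)
  have hp1 : ⨆ t, upperProb T A t ≤ 1 := iSup_le (upperProb_le_one A)
  refine le_antisymm ((hle s).trans ?_) (upperProb_nonneg A s)
  by_contra! hpos
  obtain ⟨p, hp⟩ : ∃ p : ℝ, (p : EReal) = ⨆ t, upperProb T A t :=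
    ⟨_, EReal.coe_toReal (hp1.trans_lt (EReal.coe_lt_top 1)).ne (EReal.bot_lt_zero.trans hpos).ne'⟩
  rw [← hp] at hle hpos
  have hp0 : 0 < p := EReal.coe_pos.1 hpos
  have hb : 0 < b := ha.trans hab
  have hcontract : ∀ t, upperProb T A t ≤ (p / b * a : ℝ) := fun t =>
    upperProb_le_of_forall_exists_upperProb_le (isSupermartingale_coe _)
      (fun _ => EReal.coe_nonneg.2 (by positivity)) fun ω _ hωA => by
        obtain ⟨k, hlt, hk⟩ := (hωA.1.and_eventually (eventually_ge_atTop t.length)).exists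
        exact ⟨k, hk, upperProb_le_div_mul_of_upperE_lt hf hb hp0 (fun ω hω => hω.2) hle hlt⟩
  have hle_mul : p ≤ p / b * a := EReal.coe_le_coe_iff.1 (hp ▸ iSup_le hcontract)
  have hmul_lt : p / b * a < p :=
    calc p / b * a < p / b * b := mul_lt_mul_of_pos_left hab (div_pos hp0 hb)
      _ = p := div_mul_cancel₀ p hb.ne'
  exact hle_mul.not_gt hmul_lt

theorem upperProb_processLiminf_upperE_lt_eq_zero {f : Path X → EReal} (hf : 0 ≤ f)
    (s : Situation X) : upperProb T {ω | processLiminf (upperE T f) ω < f ω} s = 0 := by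
  let ι := {q : ℚ × ℚ // 0 < q.1 ∧ q.1 < q.2}
  let A : ι → Set (Path X) := fun q =>
    {ω | (∃ᶠ k in atTop, upperE T f (Path.initial ω k) < (q.1.1 : ℝ)) ∧ (q.1.2 : ℝ) < f ω}
  have hA : ∀ q, upperProb T (A q) s = 0 := fun q =>
    upperProb_frequently_upperE_lt_and_lt_eq_zero hf (by exact_mod_cast q.2.1)
      (by exact_mod_cast q.2.2) s
  have hsub : {ω | processLiminf (upperE T f) ω < f ω} ⊆ ⋃ q, A q := by
    intro ω hω
    obtain ⟨b, hlb, hbf⟩ := EReal.lt_iff_exists_rat_btwn.1 hω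
    obtain ⟨a, hla, hab⟩ := EReal.lt_iff_exists_rat_btwn.1 hlb
    have ha : 0 < a := by
      exact_mod_cast (processLiminf_nonneg (upperE_nonneg hf) ω).trans_lt hla
    exact Set.mem_iUnion.2 ⟨⟨(a, b), ha, by exact_mod_cast hab⟩,
      frequently_lt_of_liminf_lt (by isBoundedDefault) hla, hbf⟩
  exact ((upperProb_mono hsub s).trans_eq (upperProb_iUnion_eq_zero hA)).antisymm
    (upperProb_nonneg _ s)

/-! ### Convergence theorems -/

theorem upperE_iSup {g : ℕ → Path X → EReal} (hg : ∀ n, 0 ≤ g n) (hmono : Monotone g)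
    (s : Situation X) : upperE T (fun ω => ⨆ n, g n ω) s = ⨆ n, upperE T (g n) s := by
  have hle : ∀ n t, upperE T (g n) t ≤ ⨆ n, upperE T (g n) t := fun n t =>
    le_iSup (fun n => upperE T (g n) t) n
  have hV0 : ∀ n, 0 ≤ upperE T (g n) := fun n => upperE_nonneg (hg n)
  have hS : IsSupermartingale T fun t => ⨆ n, upperE T (g n) t :=
    IsSupermartingale.iSup (fun n => isSupermartingale_upperE (boundedBelow_of_nonneg (hg n))) hV0
      fun _ _ hmn => upperE_mono (hmono hmn)
  have hnull : upperProb T (⋃ n, {ω | processLiminf (upperE T (g n)) ω < g n ω}) s = 0 :=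
    upperProb_iUnion_eq_zero fun n => upperProb_processLiminf_upperE_lt_eq_zero (hg n) s
  refine le_antisymm ?_ (iSup_le fun n => upperE_mono (fun ω => le_iSup (fun n => g n ω) n) s)
  refine upperE_le_of_forall_notMem_null hS (fun t => (hV0 0 t).trans (hle 0 t)) hnull
    fun ω _ hω => iSup_le fun n => ?_
  have hgn : g n ω ≤ processLiminf (upperE T (g n)) ω :=
    not_lt.1 fun hlt => hω (Set.mem_iUnion.2 ⟨n, hlt⟩)
  exact hgn.trans (processLiminf_mono (hle n) ω)

theorem upperE_liminf_le_of_nonneg {f : ℕ → Path X → EReal} (hf : ∀ n, 0 ≤ f n)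
    (s : Situation X) :
    upperE T (fun ω => liminf (fun n => f n ω) atTop) s ≤
      liminf (fun n => upperE T (f n) s) atTop := by
  simp only [liminf_eq_iSup_iInf_of_nat]
  rw [upperE_iSup (g := fun n ω => ⨅ i ≥ n, f i ω) (fun n ω => le_iInf₂ fun i _ => hf i ω)
    fun m n hmn ω => le_iInf₂ fun i hi => iInf₂_le i (hmn.trans hi)]
  exact iSup_mono fun n => le_iInf₂ fun i hi => upperE_mono (fun ω => iInf₂_le i hi) s

end GameTheoretic

theorem mainTheorem7_general {X : Type*} (T : GameTheoretic.ImpreciseProbabilitiesTree X)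
    (s : GameTheoretic.Situation X) (f : ℕ → GameTheoretic.Path X → EReal)
    (hf : GameTheoretic.UniformlyBoundedBelow f) :
    GameTheoretic.upperE T (fun ω => liminf (fun n => f n ω) atTop) s ≤
      liminf (fun n => GameTheoretic.upperE T (f n) s) atTop := by
  obtain ⟨M, hM⟩ := hf
  have hnonneg : ∀ n, 0 ≤ fun ω => f n ω + ((-M : ℝ) : EReal) := fun n ω =>
    calc (0 : EReal) = (M : EReal) + ((-M : ℝ) : EReal) := by
          rw [← EReal.coe_add, add_neg_cancel, EReal.coe_zero]
      _ ≤ f n ω + ((-M : ℝ) : EReal) := add_le_add_left (hM n ω) _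
  have hshifted := GameTheoretic.upperE_liminf_le_of_nonneg (T := T) hnonneg s
  simp only [GameTheoretic.liminf_add_coe, GameTheoretic.upperE_add_coe] at hshifted
  exact (EReal.addLECancellable_coe (-M)).add_le_add_iff_right.1 hshifted

theorem mainTheorem7 {X : Type*} [Finite X] [Nonempty X]
    (T : GameTheoretic.ImpreciseProbabilitiesTree X) (s : GameTheoretic.Situation X)
    (f : ℕ → GameTheoretic.Path X → EReal) (hf : GameTheoretic.UniformlyBoundedBelow f) :
    GameTheoretic.upperE T (fun ω => liminf (fun n => f n ω) atTop) s ≤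
      liminf (fun n => GameTheoretic.upperE T (f n) s) atTop := by
  exact mainTheorem7_general T s f hf
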